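/- Let $\Gamma$ be Euler's Gamma function and $\gamma$ the Euler–Mascheroni constant. For every real $x$ with $0<x<1$ and $x\neq\frac12$, the integral on the left below converges absolutely and $$\int_0^1\frac{\ln\ln(1/u)}{u^2-2\cos(2\pi x)\,u+1}\,du=\frac{\pi}{2\sin(2\pi x)}\left((1-2x)\ln(2\pi)+\ln\frac{\Gamma(1-x)}{\Gamma(x)}\right).$$ As $x\to\frac12$ (with $x\ne\frac12$), the right-hand side converges to the value of the corresponding integral at $x=\frac12$, which also converges absolutely, and $$\int_0^1\frac{\ln\ln(1/u)}{(u+1)^2}\,du=\ln\sqrt{2\pi}+\frac{\Gamma'(1/2)}{2\,\Gamma(1/2)}=\ln\sqrt{\frac{\pi}{2}}-\frac{\gamma}{2}.$$ -/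

import Mathlib

open Filter Topology MeasureTheory

/-! Substituting u = exp(-2πs) turns the integral into (sin 2πx)⁻¹ ∫₀^∞ ln(2πs) K(x,s) ds, where
K(x,s) = Re π cot π(x+is). The partial fractions of the cotangent split K into differences L(n+x) -
L(n+1-x) of Lorentzians L(a) = a/(s²+a²), and ∫₀^∞ ln(2πs) L(a) ds = (π/2) ln(2πa). Summing the
logarithms gives Gauss's limit for ln Γ(1-x) - ln Γ(x).

These integrals behave like 1/n and cannot be summed as they stand. Adding (1-2x)(L(n+2) - L(n+1))
cancels the leading order, so the sum and the integral may be exchanged; the correction telescopes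
to -(1-2x) L(1), which accounts for the term (1-2x) ln 2π.

At x = 1/2 the right-hand side is 0/0. Its limit is computed once by dominated convergence of the
integrals and once as a quotient of derivatives. -/

/-- The real part of `1 / (a + i s)`. -/
noncomputable def lorentzian (a s : ℝ) : ℝ := a / (s ^ 2 + a ^ 2)

/-! ### Logarithmic integrals of Lorentzians -/

theorem integrableOn_log_mul_inv_sqrt_cube :
    IntegrableOn (fun s : ℝ => Real.log (2 * Real.pi * s) * (√(1 + s) ^ 3)⁻¹) (Set.Ioi 0) := by
  have hmeas : Measurable (fun s : ℝ => Real.log (2 * Real.pi * s) * (√(1 + s) ^ 3)⁻¹) := by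
    fun_prop
  rw [← Set.Ioc_union_Ioi_eq_Ioi (zero_le_one' ℝ)]
  refine IntegrableOn.union ?_ ?_
  · have h1 : IntegrableOn (fun s : ℝ => Real.log (2 * Real.pi) + Real.log s) (Set.Ioc 0 1) := by
      refine (integrableOn_const (by simp)).add ?_
      exact (intervalIntegrable_iff_integrableOn_Ioc_of_le zero_le_one).1
        intervalIntegral.intervalIntegrable_log'
    refine h1.norm.mono' hmeas.aestronglyMeasurable ?_
    filter_upwards [ae_restrict_mem measurableSet_Ioc] with s hs
    rw [Real.log_mul (by positivity) hs.1.ne', norm_mul]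
    refine mul_le_of_le_one_right (norm_nonneg _) ?_
    rw [Real.norm_of_nonneg (by positivity)]
    refine inv_le_one_of_one_le₀ (one_le_pow₀ ?_)
    rw [Real.one_le_sqrt]
    linarith [hs.1]
  · have h1 : IntegrableOn (fun s : ℝ => (4 * (2 * Real.pi) ^ (1 / 4 : ℝ)) * s ^ (-5 / 4 : ℝ))
        (Set.Ioi 1) :=
      (integrableOn_Ioi_rpow_of_lt (by norm_num) one_pos).const_mul _
    refine h1.mono' hmeas.aestronglyMeasurable ?_
    filter_upwards [ae_restrict_mem measurableSet_Ioi] with s hs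
    have hs1 : (1 : ℝ) < s := hs
    have hs0 : (0 : ℝ) < s := by linarith
    have hlog : 0 ≤ Real.log (2 * Real.pi * s) := by
      apply Real.log_nonneg
      nlinarith [Real.pi_gt_three]
    rw [Real.norm_of_nonneg (by positivity)]
    have h2 := Real.log_le_rpow_div (x := 2 * Real.pi * s) (by positivity)
      (show (0 : ℝ) < 1 / 4 by norm_num)
    have h3 : (√(1 + s) ^ 3)⁻¹ ≤ s ^ (-3 / 2 : ℝ) := by
      have : s ^ (-3 / 2 : ℝ) = (√s ^ 3)⁻¹ := by
        rw [Real.sqrt_eq_rpow, ← Real.rpow_natCast, ← Real.rpow_mul hs0.le, ← Real.rpow_neg hs0.le]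
        norm_num
      rw [this]
      gcongr
      linarith
    calc _ ≤ (2 * Real.pi * s) ^ (1 / 4 : ℝ) / (1 / 4) * s ^ (-3 / 2 : ℝ) := by gcongr
      _ = _ := by
        rw [Real.mul_rpow (by positivity) hs0.le,
          show (-5 / 4 : ℝ) = 1 / 4 + -3 / 2 by norm_num, Real.rpow_add hs0]
        ring

theorem integrableOn_log_mul_of_le {f : ℝ → ℝ} (hf : Measurable f) (C : ℝ)
    (hC : ∀ s, 0 < s → |f s| ≤ C * (√(1 + s) ^ 3)⁻¹) :
    IntegrableOn (fun s : ℝ => Real.log (2 * Real.pi * s) * f s) (Set.Ioi 0) := by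
  refine (integrableOn_log_mul_inv_sqrt_cube.norm.const_mul C).mono'
    (by fun_prop) ?_
  filter_upwards [ae_restrict_mem measurableSet_Ioi] with s hs
  rw [norm_mul, norm_mul, Real.norm_of_nonneg (show 0 ≤ (√(1 + s) ^ 3)⁻¹ by positivity),
    mul_left_comm]
  exact mul_le_mul_of_nonneg_left (hC s hs) (norm_nonneg _)

theorem sqrt_one_add_pow_three_le {s : ℝ} (hs : 0 < s) : √(1 + s) ^ 3 ≤ 2 * (1 + s ^ 2) := by
  have h := Real.sq_sqrt (show 0 ≤ 1 + s by linarith)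
  have h0 : 1 ≤ √(1 + s) := by rw [Real.one_le_sqrt]; linarith
  nlinarith [sq_nonneg (√(1 + s) - 1), sq_nonneg (s - 1),
    mul_nonneg (sq_nonneg (√(1 + s))) (sub_nonneg.2 h0)]

theorem lorentzian_le {a s : ℝ} (ha : 0 < a) (hs : 0 < s) :
    |lorentzian a s| ≤ 2 * (a + a⁻¹) * (√(1 + s) ^ 3)⁻¹ := by
  have h := sqrt_one_add_pow_three_le hs
  have h0 : 0 < √(1 + s) ^ 3 := by positivity
  rw [lorentzian, abs_of_nonneg (by positivity), ← div_eq_mul_inv,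
    div_le_div_iff₀ (by positivity) h0]
  calc _ ≤ a * (2 * (1 + s ^ 2)) := by gcongr
    _ ≤ 2 * (a + a⁻¹) * (s ^ 2 + a ^ 2) := by
      have h1 : a⁻¹ * a ^ 2 = a := by field_simp
      have h2 : 0 ≤ a⁻¹ * s ^ 2 := by positivity
      have h3 : 0 ≤ a * a ^ 2 := by positivity
      nlinarith

theorem integrableOn_log_mul_lorentzian {a : ℝ} (ha : 0 < a) :
    IntegrableOn (fun s : ℝ => Real.log (2 * Real.pi * s) * lorentzian a s) (Set.Ioi 0) :=
  integrableOn_log_mul_of_le (by unfold lorentzian; fun_prop) _ fun _ hs => lorentzian_le ha hs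

/-- The inversion s ↦ 1/s preserves ds/(1+s²) and changes the sign of log s. -/
theorem integral_log_mul_inv_one_add_sq :
    ∫ s in Set.Ioi (0 : ℝ), Real.log s * (1 + s ^ 2)⁻¹ = 0 := by
  have h := integral_comp_rpow_Ioi (fun s : ℝ => Real.log s * (1 + s ^ 2)⁻¹)
    (show (-1 : ℝ) ≠ 0 by norm_num)
  have h2 : ∫ s in Set.Ioi (0 : ℝ),
      (|(-1 : ℝ)| * s ^ ((-1 : ℝ) - 1)) • (Real.log (s ^ (-1 : ℝ)) * (1 + (s ^ (-1 : ℝ)) ^ 2)⁻¹) =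
      ∫ s in Set.Ioi (0 : ℝ), -(Real.log s * (1 + s ^ 2)⁻¹) := by
    refine setIntegral_congr_fun measurableSet_Ioi fun s hs => ?_
    have hs : 0 < s := hs
    have e : s ^ ((-1 : ℝ) - 1) = (s ^ 2)⁻¹ := by
      rw [show (-1 : ℝ) - 1 = -(2 : ℕ) by norm_num, Real.rpow_neg hs.le, Real.rpow_natCast]
    simp only [e, Real.rpow_neg_one, Real.log_inv, smul_eq_mul, abs_neg, abs_one, one_mul]
    field_simp
    ring
  rw [h2, integral_neg] at h
  linarith

theorem integral_log_mul_lorentzian {a : ℝ} (ha : 0 < a) :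
    ∫ s in Set.Ioi (0 : ℝ), Real.log (2 * Real.pi * s) * lorentzian a s =
      Real.pi / 2 * Real.log (2 * Real.pi * a) := by
  have h := integral_comp_mul_left_Ioi'
    (fun s : ℝ => Real.log (2 * Real.pi * s) * lorentzian a s) 0 ha
  rw [mul_zero] at h
  have hcongr : Set.EqOn
      (fun s => a • (Real.log (2 * Real.pi * (a * s)) * lorentzian a (a * s)))
      (fun s => Real.log (2 * Real.pi * a) * (1 + s ^ 2)⁻¹ + Real.log s * (1 + s ^ 2)⁻¹)
      (Set.Ioi 0) := fun s hs => by
    have hs : 0 < s := hs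
    have e : a * lorentzian a (a * s) = (1 + s ^ 2)⁻¹ := by
      unfold lorentzian
      field_simp
      ring
    simp only [smul_eq_mul]
    rw [mul_left_comm, e, ← mul_assoc, Real.log_mul (by positivity) hs.ne', add_mul]
  have hlog : IntegrableOn (fun s : ℝ => Real.log s * (1 + s ^ 2)⁻¹) (Set.Ioi 0) := by
    have h1 := (integrableOn_log_mul_lorentzian one_pos).sub
      ((integrable_inv_one_add_sq.integrableOn (s := Set.Ioi 0)).const_mul (Real.log (2 * Real.pi)))
    refine h1.congr_fun (fun s hs => ?_) measurableSet_Ioi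
    simp only [lorentzian, Pi.sub_apply]
    rw [Real.log_mul (by positivity) (ne_of_gt hs), one_pow, add_comm (s ^ 2), one_div]
    ring
  rw [← h, ← integral_smul, setIntegral_congr_fun measurableSet_Ioi hcongr, integral_add
    (integrable_inv_one_add_sq.integrableOn.const_mul _) hlog, integral_log_mul_inv_one_add_sq,
    integral_const_mul, integral_Ioi_inv_one_add_sq]
  simp
  ring

/-! ### Uniform bounds for the corrected terms -/

theorem re_inv_add_mul_I (a s : ℝ) : ((a + s * Complex.I : ℂ)⁻¹).re = lorentzian a s := by
  simp [Complex.inv_re, Complex.normSq_apply, lorentzian, sq, add_comm]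

/-- A summable rearrangement of the partial fraction expansion of the Poisson kernel. -/
noncomputable def poissonTerm (x : ℝ) (n : ℕ) (s : ℝ) : ℝ :=
  lorentzian (n + x) s - lorentzian (n + 1 - x) s +
    (1 - 2 * x) * (lorentzian (n + 2) s - lorentzian (n + 1) s)

theorem norm_inv_mul_sub_inv_mul_le {a b c d : ℂ} {D : ℝ} (hD : 0 < D)
    (ha : D ≤ ‖a‖) (hb : D ≤ ‖b‖) (hc : D ≤ ‖c‖) (hd : D ≤ ‖d‖)
    (hca : ‖c - a‖ ≤ 2) (hdb : ‖d - b‖ ≤ 2) :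
    ‖a⁻¹ * b⁻¹ - c⁻¹ * d⁻¹‖ ≤ 4 * (D ^ 3)⁻¹ := by
  have ne {w : ℂ} (h : D ≤ ‖w‖) : w ≠ 0 := norm_pos_iff.1 (hD.trans_le h)
  have ha0 := ne ha
  have hb0 := ne hb
  have hc0 := ne hc
  have hd0 := ne hd
  have le {w : ℂ} (h : D ≤ ‖w‖) : ‖w⁻¹‖ ≤ D⁻¹ := by
    rw [norm_inv]
    gcongr
  -- Replace one factor at a time, so that each piece has three inverse factors.
  have e : a⁻¹ * b⁻¹ - c⁻¹ * d⁻¹ =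
      (d - b) * (a⁻¹ * b⁻¹ * d⁻¹) + (c - a) * (a⁻¹ * c⁻¹ * d⁻¹) := by
    field_simp
    ring
  have h3 {u v w : ℂ} (hu : D ≤ ‖u‖) (hv : D ≤ ‖v‖) (hw : D ≤ ‖w‖) :
      ‖u⁻¹ * v⁻¹ * w⁻¹‖ ≤ (D ^ 3)⁻¹ := by
    rw [norm_mul, norm_mul]
    calc _ ≤ D⁻¹ * D⁻¹ * D⁻¹ := by
          gcongr
          exacts [le hu, le hv, le hw]
      _ = _ := by rw [← inv_pow]; ring
  rw [e]
  refine (norm_add_le _ _).trans ?_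
  rw [norm_mul (d - b), norm_mul (c - a)]
  have h4 := mul_le_mul hdb (h3 ha hb hd) (norm_nonneg _) zero_le_two
  have h5 := mul_le_mul hca (h3 ha hc hd) (norm_nonneg _) zero_le_two
  linarith

/-- The norm dominates both c(n+1) and c(1+s), hence their geometric mean. Its cube separates n from
s, with each exponent 3/2 just enough for convergence. -/
theorem mul_sqrt_mul_sqrt_le_norm {c a s : ℝ} {n : ℕ} (hc0 : 0 < c) (hc : 2 * c ≤ 1)
    (ha : n + 2 * c ≤ a) (hs : 0 < s) :
    c * √(n + 1) * √(1 + s) ≤ ‖(a + s * Complex.I : ℂ)‖ := by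
  have hn : (0 : ℝ) ≤ n := n.cast_nonneg
  have h1 := Complex.abs_re_le_norm (a + s * Complex.I)
  have h2 := Complex.abs_im_le_norm (a + s * Complex.I)
  simp only [Complex.add_re, Complex.ofReal_re, Complex.re_ofReal_mul, Complex.I_re, mul_zero,
    add_zero, Complex.add_im, Complex.ofReal_im, Complex.im_ofReal_mul, Complex.I_im, mul_one,
    zero_add] at h1 h2
  rw [abs_of_pos (by linarith)] at h1
  rw [abs_of_pos hs] at h2
  have h3 : c * (n + 1) ≤ ‖(a + s * Complex.I : ℂ)‖ := by nlinarith
  have h4 : c * (1 + s) ≤ ‖(a + s * Complex.I : ℂ)‖ := by nlinarith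
  refine abs_le_of_sq_le_sq' ?_ (norm_nonneg _) |>.2
  rw [mul_pow, mul_pow, Real.sq_sqrt (by positivity), Real.sq_sqrt (by positivity)]
  calc _ = (c * (n + 1)) * (c * (1 + s)) := by ring
    _ ≤ _ := by rw [sq]; gcongr

theorem exists_abs_poissonTerm_le {x : ℝ} (hx0 : 0 < x) (hx1 : x < 1) :
    ∃ C, ∀ (n : ℕ) (s : ℝ), 0 < s →
      |poissonTerm x n s| ≤ C * (√(n + 1) ^ 3)⁻¹ * (√(1 + s) ^ 3)⁻¹ := by
  obtain ⟨c, hc0, hcx, hcx'⟩ : ∃ c : ℝ, 0 < c ∧ 2 * c ≤ x ∧ 2 * c ≤ 1 - x := by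
    refine ⟨min x (1 - x) / 2, ?_, ?_, ?_⟩
    · have : 0 < min x (1 - x) := lt_min hx0 (by linarith)
      linarith
    · linarith [min_le_left x (1 - x)]
    · linarith [min_le_right x (1 - x)]
  refine ⟨4 * (c ^ 3)⁻¹, fun n s hs => ?_⟩
  have hn : (0 : ℝ) ≤ n := n.cast_nonneg
  have hD (a : ℝ) (ha : n + 2 * c ≤ a) :=
    mul_sqrt_mul_sqrt_le_norm hc0 (by linarith) ha hs
  have hDpos : 0 < c * √(n + 1) * √(1 + s) := by positivity
  have hA := hD (n + x) (by linarith)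
  have hB := hD (n + 1 - x) (by linarith)
  have hC := hD (n + 1) (by linarith)
  have hE := hD (n + 2) (by linarith)
  have ne {w : ℂ} (h : c * √(n + 1) * √(1 + s) ≤ ‖w‖) : w ≠ 0 :=
    norm_pos_iff.1 (hDpos.trans_le h)
  have key := norm_inv_mul_sub_inv_mul_le hDpos hA hB hC hE
    (by
      rw [show ((n + 1 : ℝ) : ℂ) + s * Complex.I - (((n + x : ℝ) : ℂ) + s * Complex.I) =
        ((1 - x : ℝ) : ℂ) by push_cast; ring, Complex.norm_real, Real.norm_eq_abs, abs_le]
      constructor <;> linarith)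
    (by
      rw [show ((n + 2 : ℝ) : ℂ) + s * Complex.I - (((n + 1 - x : ℝ) : ℂ) + s * Complex.I) =
        ((1 + x : ℝ) : ℂ) by push_cast; ring, Complex.norm_real, Real.norm_eq_abs, abs_le]
      constructor <;> linarith)
  -- Each difference of inverses is a product of inverses: 1/A - 1/B has numerator B - A = 1-2x, and
  -- the correction has numerator 1.
  have e : poissonTerm x n s = (1 - 2 * x) *
      ((((n + x : ℝ) : ℂ) + s * Complex.I)⁻¹ * (((n + 1 - x : ℝ) : ℂ) + s * Complex.I)⁻¹ -
      (((n + 1 : ℝ) : ℂ) + s * Complex.I)⁻¹ * (((n + 2 : ℝ) : ℂ) + s * Complex.I)⁻¹).re := by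
    rw [← Complex.re_ofReal_mul, poissonTerm]
    simp only [← re_inv_add_mul_I]
    rw [← Complex.sub_re, ← Complex.sub_re, ← Complex.re_ofReal_mul, ← Complex.add_re]
    congr 1
    have hA0 := ne hA
    have hB0 := ne hB
    have hC0 := ne hC
    have hE0 := ne hE
    field_simp
    push_cast
    ring
  rw [e, abs_mul]
  calc _ ≤ 1 * (4 * ((c * √(n + 1) * √(1 + s)) ^ 3)⁻¹) := by
        gcongr
        · rw [abs_le]; constructor <;> linarith
        · exact (Complex.abs_re_le_norm _).trans key
    _ = _ := by simp only [mul_pow, mul_inv]; ring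

/-! ### Cotangent expansion of the strip kernel -/

theorem re_cot_add_mul_I (A B : ℝ) (hB : B ≠ 0) :
    (Complex.cot (A + B * Complex.I)).re =
      Real.sin (2 * A) / (Real.cosh (2 * B) - Real.cos (2 * A)) := by
  have hs : 0 < Real.sinh B ^ 2 := by
    have : Real.sinh B ≠ 0 := by simpa using hB
    positivity
  rw [Complex.cot, Complex.sin_add_mul_I, Complex.cos_add_mul_I, ← Complex.ofReal_sin,
    ← Complex.ofReal_cos, ← Complex.ofReal_sinh, ← Complex.ofReal_cosh, Complex.div_re]
  simp only [Complex.normSq_apply, Complex.add_re, Complex.sub_re, Complex.add_im, Complex.sub_im,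
    Complex.mul_re, Complex.mul_im, Complex.ofReal_re, Complex.ofReal_im, Complex.I_re,
    Complex.I_im]
  have h1 := Real.cosh_sq B
  have h2 := Real.sin_sq_add_cos_sq A
  have h3 : Real.cosh (2 * B) - Real.cos (2 * A) = 2 * (Real.sin A ^ 2 + Real.sinh B ^ 2) := by
    rw [Real.cosh_two_mul, Real.cos_two_mul]
    linarith
  have h4 : 0 < Real.sin A ^ 2 + Real.sinh B ^ 2 := by positivity
  rw [h3, Real.sin_two_mul]
  have h5 : (Real.sin A * Real.cosh B) ^ 2 + (Real.cos A * Real.sinh B) ^ 2 =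
      Real.sin A ^ 2 + Real.sinh B ^ 2 := by
    rw [mul_pow, mul_pow, h1]
    linear_combination Real.sinh B ^ 2 * h2
  rw [← add_div, div_eq_div_iff (by nlinarith) (by positivity)]
  linear_combination (-(2 * Real.sin A * Real.cos A) * h5) +
    2 * Real.sin A * Real.cos A * (Real.sin A ^ 2 + Real.sinh B ^ 2) * h1

/-- The kernel `π sin (2πx) / (cosh (2πs) - cos (2πx))`. -/
noncomputable def poissonStripKernel (x s : ℝ) : ℝ :=
  Real.pi * Real.sin (2 * Real.pi * x) /
    (Real.cosh (2 * Real.pi * s) - Real.cos (2 * Real.pi * x))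

theorem re_pi_mul_cot_pi_mul (x : ℝ) {s : ℝ} (hs : 0 < s) :
    (Real.pi * Complex.cot (Real.pi * (x + s * Complex.I))).re = poissonStripKernel x s := by
  have h := re_cot_add_mul_I (Real.pi * x) (Real.pi * s) (by positivity)
  rw [Complex.re_ofReal_mul, poissonStripKernel, mul_div_assoc, mul_assoc 2, mul_assoc 2, ← h]
  push_cast
  ring_nf

/-- Pairing z+n with z-(n+1), rather than with z-n, changes the classical partial sums only by
1/(z+N), which vanishes. -/
theorem tendsto_sum_inv_add_inv_sub {z : ℂ} (hz : z ∈ Complex.integerComplement) :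
    Tendsto (fun N : ℕ => ∑ n ∈ Finset.range N, ((z + n)⁻¹ + (z - (n + 1))⁻¹)) atTop
      (𝓝 (Real.pi * Complex.cot (Real.pi * z))) := by
  have h1 := (tendsto_logDeriv_euler_cot_sub hz).add_const (1 / z)
  have h2 : Tendsto (fun N : ℕ => (z + N)⁻¹) atTop (𝓝 0) := by
    refine tendsto_inv₀_cobounded.comp ?_
    refine tendsto_norm_atTop_iff_cobounded.1 (tendsto_atTop_mono (fun N => ?_)
      (tendsto_atTop_add_const_right _ (-‖z‖) tendsto_natCast_atTop_atTop))
    have := norm_sub_le (z + N) z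
    rw [add_sub_cancel_left, Complex.norm_natCast] at this
    linarith
  have h3 := h1.sub h2
  rw [sub_add_cancel, sub_zero] at h3
  refine h3.congr fun N => ?_
  induction N with
  | zero => simp
  | succ N ih =>
    rw [Finset.sum_range_succ, Finset.sum_range_succ, ← ih, cotTerm]
    push_cast
    ring

theorem tendsto_lorentzian_natCast_add_one (s : ℝ) :
    Tendsto (fun n : ℕ => lorentzian (n + 1) s) atTop (𝓝 0) := by
  refine squeeze_zero (fun n => by unfold lorentzian; positivity) (fun n => ?_)
    (tendsto_one_div_add_atTop_nhds_zero_nat (𝕜 := ℝ))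
  rw [lorentzian, div_le_div_iff₀ (by positivity) (by positivity)]
  nlinarith [sq_nonneg s]

theorem tendsto_sum_poissonTerm (x : ℝ) {s : ℝ} (hs : 0 < s) :
    Tendsto (fun N : ℕ => ∑ n ∈ Finset.range N, poissonTerm x n s) atTop
      (𝓝 (poissonStripKernel x s - (1 - 2 * x) * lorentzian 1 s)) := by
  have hz : (x + s * Complex.I : ℂ) ∈ Complex.integerComplement := by
    rintro ⟨n, hn⟩
    have := congr_arg Complex.im hn
    simp at this
    exact hs.ne this
  have h1 := (Complex.continuous_re.tendsto _).comp (tendsto_sum_inv_add_inv_sub hz)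
  rw [re_pi_mul_cot_pi_mul x hs] at h1
  have h2 := h1.add (((tendsto_lorentzian_natCast_add_one s).sub_const
    (lorentzian 1 s)).const_mul (1 - 2 * x))
  rw [zero_sub, mul_neg, ← sub_eq_add_neg] at h2
  refine h2.congr fun N => ?_
  have e1 (n : ℕ) : (((x + s * Complex.I : ℂ) + n)⁻¹).re = lorentzian (n + x) s := by
    rw [← re_inv_add_mul_I]
    push_cast
    ring_nf
  have e2 (n : ℕ) : (((x + s * Complex.I : ℂ) - (n + 1))⁻¹).re = -lorentzian (n + 1 - x) s := by
    have : ((x + s * Complex.I : ℂ) - (n + 1)) = ((-(n + 1 - x) : ℝ) : ℂ) + s * Complex.I := by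
      push_cast
      ring
    rw [this, re_inv_add_mul_I, lorentzian, lorentzian, neg_sq, neg_div]
  simp only [Function.comp_apply, Complex.re_sum, Complex.add_re, e1, e2]
  induction N with
  | zero => simp
  | succ N ih =>
    rw [Finset.sum_range_succ, Finset.sum_range_succ, ← ih, poissonTerm]
    push_cast
    rw [add_assoc (N : ℝ) 1 1, one_add_one_eq_two]
    ring

theorem summable_inv_sqrt_cube : Summable fun n : ℕ => (√((n : ℝ) + 1) ^ 3)⁻¹ := by
  have h : Summable fun n : ℕ => ((n : ℝ) ^ (3 / 2 : ℝ))⁻¹ :=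
    Real.summable_nat_rpow_inv.2 (by norm_num)
  refine ((summable_nat_add_iff 1).2 h).congr fun n => ?_
  rw [Real.sqrt_eq_rpow, ← Real.rpow_natCast, ← Real.rpow_mul (by positivity)]
  norm_num

theorem measurable_poissonTerm (x : ℝ) (n : ℕ) : Measurable (poissonTerm x n) := by
  unfold poissonTerm lorentzian
  fun_prop

theorem hasSum_poissonTerm {x : ℝ} (hx0 : 0 < x) (hx1 : x < 1) {s : ℝ} (hs : 0 < s) :
    HasSum (fun n => poissonTerm x n s)
      (poissonStripKernel x s - (1 - 2 * x) * lorentzian 1 s) := by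
  obtain ⟨C, hC⟩ := exists_abs_poissonTerm_le hx0 hx1
  refine (Summable.hasSum_iff_tendsto_nat ?_).2 (tendsto_sum_poissonTerm x hs)
  exact Summable.of_norm_bounded ((summable_inv_sqrt_cube.mul_left C).mul_right _)
    fun n => hC n s hs

/-! ### Termwise integration and the Gamma function -/

theorem integrableOn_log_mul_poissonStripKernel {x : ℝ} (hx0 : 0 < x) (hx1 : x < 1) :
    IntegrableOn (fun s => Real.log (2 * Real.pi * s) * poissonStripKernel x s) (Set.Ioi 0) := by
  obtain ⟨C, hC⟩ := exists_abs_poissonTerm_le hx0 hx1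
  have h1 : IntegrableOn (fun s => Real.log (2 * Real.pi * s) *
      (poissonStripKernel x s - (1 - 2 * x) * lorentzian 1 s)) (Set.Ioi 0) := by
    refine integrableOn_log_mul_of_le (by unfold poissonStripKernel lorentzian; fun_prop)
      (C * ∑' n : ℕ, (√((n : ℝ) + 1) ^ 3)⁻¹) fun s hs => ?_
    rw [← (hasSum_poissonTerm hx0 hx1 hs).tsum_eq]
    exact tsum_of_norm_bounded (f := fun n => poissonTerm x n s)
      ((summable_inv_sqrt_cube.hasSum.mul_left C).mul_right _) fun n => hC n s hs
  refine (h1.add ((integrableOn_log_mul_lorentzian one_pos).const_mul (1 - 2 * x))).congr_fun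
    (fun s _ => ?_) measurableSet_Ioi
  simp only [Pi.add_apply]
  ring

theorem integral_log_mul_poissonTerm {x : ℝ} (hx0 : 0 < x) (hx1 : x < 1) (n : ℕ) :
    ∫ s in Set.Ioi (0 : ℝ), Real.log (2 * Real.pi * s) * poissonTerm x n s =
      Real.pi / 2 * (Real.log (x + n) - Real.log (1 - x + n) +
        (1 - 2 * x) * (Real.log (n + 2) - Real.log (n + 1))) := by
  have hn : (0 : ℝ) ≤ n := n.cast_nonneg
  have ha : 0 < n + x := by linarith
  have hb : 0 < n + 1 - x := by linarith
  have hc : (0 : ℝ) < n + 2 := by linarith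
  have hd : (0 : ℝ) < n + 1 := by linarith
  have e : (fun s => Real.log (2 * Real.pi * s) * poissonTerm x n s) = fun s =>
      (Real.log (2 * Real.pi * s) * lorentzian (n + x) s -
        Real.log (2 * Real.pi * s) * lorentzian (n + 1 - x) s) +
      (1 - 2 * x) * (Real.log (2 * Real.pi * s) * lorentzian (n + 2) s -
        Real.log (2 * Real.pi * s) * lorentzian (n + 1) s) := by
    ext s
    rw [poissonTerm]
    ring
  have ia := integrableOn_log_mul_lorentzian ha
  have ib := integrableOn_log_mul_lorentzian hb
  have ic := integrableOn_log_mul_lorentzian hc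
  have id := integrableOn_log_mul_lorentzian hd
  have iab := ia.sub ib
  have icd := (ic.sub id).const_mul (1 - 2 * x)
  simp only [Pi.sub_def] at iab icd
  rw [e, integral_add iab icd, integral_const_mul, integral_sub ia ib, integral_sub ic id,
    integral_log_mul_lorentzian ha,
    integral_log_mul_lorentzian hb, integral_log_mul_lorentzian hc, integral_log_mul_lorentzian hd]
  have h2 : 2 * Real.pi ≠ 0 := by positivity
  rw [Real.log_mul h2 ha.ne', Real.log_mul h2 hb.ne', Real.log_mul h2 hc.ne',
    Real.log_mul h2 hd.ne', show 1 - x + (n : ℝ) = n + 1 - x by ring, add_comm x]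
  ring

theorem tendsto_sum_log_sub_log {x : ℝ} (hx0 : 0 < x) (hx1 : x < 1) :
    Tendsto (fun N : ℕ => ∑ n ∈ Finset.range (N + 1), (Real.log (x + n) - Real.log (1 - x + n) +
        (1 - 2 * x) * (Real.log (n + 2) - Real.log (n + 1)))) atTop
      (𝓝 (Real.log (Real.Gamma (1 - x)) - Real.log (Real.Gamma x))) := by
  have h1 := (Real.BohrMollerup.tendsto_log_gamma (show 0 < 1 - x by linarith)).sub
    (Real.BohrMollerup.tendsto_log_gamma hx0)
  have h2 := Real.tendsto_log_nat_add_one_sub_log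
  -- The correction telescopes to ln(N+2), while Gauss's formula has ln N; two vanishing increments
  -- bridge the gap.
  have h3 := h1.add ((((tendsto_add_atTop_iff_nat 1).2 h2).add h2).const_mul (1 - 2 * x))
  rw [add_zero, mul_zero, add_zero] at h3
  refine h3.congr fun N => ?_
  have h4 : ∑ n ∈ Finset.range (N + 1), (Real.log ((n : ℝ) + 2) - Real.log (n + 1)) =
      Real.log (N + 2) := by
    have := Finset.sum_range_sub (fun n : ℕ => Real.log ((n : ℝ) + 1)) (N + 1)
    push_cast at this
    simp only [add_assoc, one_add_one_eq_two, zero_add, Real.log_one, sub_zero] at this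
    exact this
  rw [Finset.sum_add_distrib, ← Finset.mul_sum, h4, Finset.sum_sub_distrib]
  simp only [Real.BohrMollerup.logGammaSeq]
  push_cast
  rw [add_assoc (N : ℝ) 1 1, one_add_one_eq_two]
  ring

theorem integral_log_mul_poissonStripKernel {x : ℝ} (hx0 : 0 < x) (hx1 : x < 1) :
    ∫ s in Set.Ioi (0 : ℝ), Real.log (2 * Real.pi * s) * poissonStripKernel x s =
      Real.pi / 2 * ((1 - 2 * x) * Real.log (2 * Real.pi) +
        Real.log (Real.Gamma (1 - x) / Real.Gamma x)) := by
  obtain ⟨C, hC⟩ := exists_abs_poissonTerm_le hx0 hx1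
  have hint (n : ℕ) : IntegrableOn
      (fun s => Real.log (2 * Real.pi * s) * poissonTerm x n s) (Set.Ioi 0) :=
    integrableOn_log_mul_of_le (measurable_poissonTerm x n) _ (hC n)
  have hsum : Summable fun n : ℕ => ∫ s in Set.Ioi (0 : ℝ),
      ‖Real.log (2 * Real.pi * s) * poissonTerm x n s‖ := by
    refine Summable.of_nonneg_of_le (fun n => integral_nonneg fun s => norm_nonneg _) (fun n => ?_)
      ((summable_inv_sqrt_cube.mul_left C).mul_right
        (∫ s in Set.Ioi (0 : ℝ), ‖Real.log (2 * Real.pi * s) * (√(1 + s) ^ 3)⁻¹‖))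
    rw [← integral_const_mul]
    refine setIntegral_mono_on (hint n).norm
      (integrableOn_log_mul_inv_sqrt_cube.norm.const_mul _) measurableSet_Ioi fun s hs => ?_
    rw [norm_mul, norm_mul, Real.norm_of_nonneg (show 0 ≤ (√(1 + s) ^ 3)⁻¹ by positivity),
      mul_left_comm]
    exact mul_le_mul_of_nonneg_left (hC n s hs) (norm_nonneg _)
  have h1 := (hasSum_integral_of_summable_integral_norm hint hsum).tendsto_sum_nat
  simp only [integral_log_mul_poissonTerm hx0 hx1, ← Finset.mul_sum] at h1
  have h2 := tendsto_nhds_unique ((tendsto_add_atTop_iff_nat 1).2 h1)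
    ((tendsto_sum_log_sub_log hx0 hx1).const_mul (Real.pi / 2))
  have h3 : ∫ s in Set.Ioi (0 : ℝ), ∑' n, Real.log (2 * Real.pi * s) * poissonTerm x n s =
      ∫ s in Set.Ioi (0 : ℝ), (Real.log (2 * Real.pi * s) * poissonStripKernel x s -
        (1 - 2 * x) * (Real.log (2 * Real.pi * s) * lorentzian 1 s)) := by
    refine setIntegral_congr_fun measurableSet_Ioi fun s hs => ?_
    simp only [tsum_mul_left, (hasSum_poissonTerm hx0 hx1 hs).tsum_eq]
    ring
  rw [h3, integral_sub (integrableOn_log_mul_poissonStripKernel hx0 hx1)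
    ((integrableOn_log_mul_lorentzian one_pos).const_mul _), integral_const_mul,
    integral_log_mul_lorentzian one_pos, mul_one] at h2
  rw [Real.log_div (Real.Gamma_pos_of_pos (by linarith)).ne' (Real.Gamma_pos_of_pos hx0).ne']
  linear_combination h2

/-! ### The substitution u = exp(-2πs) -/

theorem image_exp_neg_two_pi_mul :
    (fun s : ℝ => Real.exp (-(2 * Real.pi * s))) '' Set.Ioi 0 = Set.Ioo 0 1 := by
  ext u
  constructor
  · rintro ⟨s, hs, rfl⟩
    have hs : 0 < s := hs
    exact ⟨Real.exp_pos _, by rw [Real.exp_lt_one_iff, neg_lt_zero]; positivity⟩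
  · rintro ⟨h0, h1⟩
    refine ⟨-Real.log u / (2 * Real.pi), ?_, ?_⟩
    · exact div_pos (neg_pos.2 (Real.log_neg h0 h1)) (by positivity)
    · have : -(2 * Real.pi * (-Real.log u / (2 * Real.pi))) = Real.log u := by field_simp
      simp only [this, Real.exp_log h0]

theorem hasDerivWithinAt_exp_neg_two_pi_mul (s : ℝ) (t : Set ℝ) :
    HasDerivWithinAt (fun s : ℝ => Real.exp (-(2 * Real.pi * s)))
      (Real.exp (-(2 * Real.pi * s)) * (-(2 * Real.pi * 1))) t s :=
  (((hasDerivAt_id s).const_mul (2 * Real.pi)).neg.exp).hasDerivWithinAt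

theorem injOn_exp_neg_two_pi_mul (t : Set ℝ) :
    Set.InjOn (fun s : ℝ => Real.exp (-(2 * Real.pi * s))) t := by
  intro a _ b _ h
  have := Real.exp_injective h
  simpa [Real.pi_ne_zero] using this

theorem exp_smul_log_log_div_eq {x s : ℝ} (hx : Real.sin (2 * Real.pi * x) ≠ 0) (hs : 0 < s) :
    |Real.exp (-(2 * Real.pi * s)) * (-(2 * Real.pi * 1))| •
      (Real.log (Real.log (1 / Real.exp (-(2 * Real.pi * s)))) /
        (Real.exp (-(2 * Real.pi * s)) ^ 2 -
          2 * Real.cos (2 * Real.pi * x) * Real.exp (-(2 * Real.pi * s)) + 1)) =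
      (Real.sin (2 * Real.pi * x))⁻¹ * (Real.log (2 * Real.pi * s) * poissonStripKernel x s) := by
  have hcosh : Real.cos (2 * Real.pi * x) < Real.cosh (2 * Real.pi * s) :=
    (Real.cos_le_one _).trans_lt (Real.one_lt_cosh.2 (by positivity))
  set e := Real.exp (-(2 * Real.pi * s)) with he
  have he0 : 0 < e := Real.exp_pos _
  have h1 : e ^ 2 - 2 * Real.cos (2 * Real.pi * x) * e + 1 =
      2 * e * (Real.cosh (2 * Real.pi * s) - Real.cos (2 * Real.pi * x)) := by
    have : Real.exp (2 * Real.pi * s) * e = 1 := by rw [he, ← Real.exp_add]; simp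
    rw [Real.cosh_eq, ← he]
    linear_combination -this
  have h2 : Real.log (1 / e) = 2 * Real.pi * s := by
    rw [one_div, Real.log_inv, he, Real.log_exp, neg_neg]
  rw [h1, h2, poissonStripKernel, mul_neg, abs_neg, abs_of_pos (by positivity), smul_eq_mul]
  have h3 := (sub_pos.2 hcosh).ne'
  field_simp

theorem sin_two_pi_mul_ne_zero {x : ℝ} (hx0 : 0 < x) (hx1 : x < 1) (hx : x ≠ 1 / 2) :
    Real.sin (2 * Real.pi * x) ≠ 0 := by
  rw [Real.sin_ne_zero_iff]
  intro n hn
  have h : (n : ℝ) = 2 * x := by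
    have := Real.pi_pos.ne'
    field_simp at hn ⊢
    linarith
  have h0 : (0 : ℝ) < n := by linarith
  have h1 : (n : ℝ) < 2 := by linarith
  norm_cast at h0 h1
  have : n = 1 := by omega
  subst this
  apply hx
  push_cast at h
  linarith

theorem intervalIntegrable_log_log_div {x : ℝ} (hx0 : 0 < x) (hx1 : x < 1) (hx : x ≠ 1 / 2) :
    IntervalIntegrable (fun u : ℝ =>
      Real.log (Real.log (1 / u)) / (u ^ 2 - 2 * Real.cos (2 * Real.pi * x) * u + 1))
      volume 0 1 := by
  rw [intervalIntegrable_iff_integrableOn_Ioo_of_le zero_le_one, ← image_exp_neg_two_pi_mul,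
    integrableOn_image_iff_integrableOn_abs_deriv_smul measurableSet_Ioi
      (fun s _ => hasDerivWithinAt_exp_neg_two_pi_mul s _) (injOn_exp_neg_two_pi_mul _)]
  exact IntegrableOn.congr_fun ((integrableOn_log_mul_poissonStripKernel hx0 hx1).const_mul _)
    (fun s hs => (exp_smul_log_log_div_eq (sin_two_pi_mul_ne_zero hx0 hx1 hx) hs).symm)
    measurableSet_Ioi

theorem integral_log_log_div {x : ℝ} (hx0 : 0 < x) (hx1 : x < 1) (hx : x ≠ 1 / 2) :
    ∫ u in (0 : ℝ)..1,
      Real.log (Real.log (1 / u)) / (u ^ 2 - 2 * Real.cos (2 * Real.pi * x) * u + 1) =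
      Real.pi / (2 * Real.sin (2 * Real.pi * x)) *
        ((1 - 2 * x) * Real.log (2 * Real.pi) +
          Real.log (Real.Gamma (1 - x) / Real.Gamma x)) := by
  have hsin := sin_two_pi_mul_ne_zero hx0 hx1 hx
  rw [intervalIntegral.integral_of_le zero_le_one, integral_Ioc_eq_integral_Ioo,
    ← image_exp_neg_two_pi_mul, integral_image_eq_integral_abs_deriv_smul measurableSet_Ioi
      (fun s _ => hasDerivWithinAt_exp_neg_two_pi_mul s _) (injOn_exp_neg_two_pi_mul _),
    setIntegral_congr_fun measurableSet_Ioi (fun s hs => exp_smul_log_log_div_eq hsin hs),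
    integral_const_mul, integral_log_mul_poissonStripKernel hx0 hx1]
  field_simp

/-! ### The limit at x = 1/2 -/

theorem intervalIntegrable_log_log :
    IntervalIntegrable (fun u : ℝ => Real.log (Real.log (1 / u))) volume 0 1 := by
  -- At x = 1/4 the denominator is u²+1, a bounded factor that can be multiplied away.
  have h := intervalIntegrable_log_log_div (x := 1 / 4) (by norm_num) (by norm_num) (by norm_num)
  have hc : Real.cos (2 * Real.pi * (1 / 4)) = 0 := by
    rw [← Real.cos_pi_div_two]
    ring_nf
  simp only [hc] at h
  refine (h.mul_continuousOn (g := fun u => u ^ 2 + 1) (by fun_prop)).congr fun u _ => ?_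
  have : u ^ 2 + 1 ≠ 0 := by positivity
  simp only [mul_zero, zero_mul, sub_zero]
  field_simp

theorem tendsto_integral_log_log_div :
    Tendsto (fun x : ℝ => ∫ u in (0 : ℝ)..1,
      Real.log (Real.log (1 / u)) / (u ^ 2 - 2 * Real.cos (2 * Real.pi * x) * u + 1))
      (𝓝 (1 / 2)) (𝓝 (∫ u in (0 : ℝ)..1, Real.log (Real.log (1 / u)) / (u + 1) ^ 2)) := by
  have hcos : Real.cos (2 * Real.pi * (1 / 2)) = -1 := by
    rw [← Real.cos_pi]
    ring_nf
  -- A negative cosine makes the denominator at least 1 for u in (0,1], so |ln ln(1/u)| is a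
  -- dominating function.
  have hev : ∀ᶠ x : ℝ in 𝓝 (1 / 2), Real.cos (2 * Real.pi * x) < 0 := by
    have hcont : Continuous fun x : ℝ => Real.cos (2 * Real.pi * x) := by fun_prop
    exact hcont.continuousAt.eventually_lt_const (by simp only [hcos]; norm_num)
  refine intervalIntegral.tendsto_integral_filter_of_dominated_convergence
    (fun u => ‖Real.log (Real.log (1 / u))‖) ?_ ?_ intervalIntegrable_log_log.norm ?_
  · exact Eventually.of_forall fun x => by
      apply Measurable.aestronglyMeasurable
      fun_prop
  · filter_upwards [hev] with x hx
    refine ae_of_all _ fun u hu => ?_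
    rw [Set.uIoc_of_le zero_le_one] at hu
    rw [norm_div]
    refine div_le_self (norm_nonneg _) ?_
    refine le_trans ?_ (Real.le_norm_self _)
    nlinarith [hu.1, sq_nonneg u]
  · refine ae_of_all _ fun u hu => ?_
    rw [Set.uIoc_of_le zero_le_one] at hu
    have h0 : 0 < u := hu.1
    have e : (u + 1) ^ 2 = u ^ 2 - 2 * Real.cos (2 * Real.pi * (1 / 2)) * u + 1 := by
      rw [hcos]
      ring
    rw [e]
    refine Tendsto.div tendsto_const_nhds ?_ (by rw [← e]; positivity)
    exact Continuous.tendsto (by fun_prop) _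

theorem hasDerivAt_log_Gamma_ratio :
    HasDerivAt (fun x : ℝ => Real.pi / 2 * ((1 - 2 * x) * Real.log (2 * Real.pi) +
        Real.log (Real.Gamma (1 - x) / Real.Gamma x)))
      (-Real.pi * (Real.log (2 * Real.pi) + deriv Real.Gamma (1 / 2) / Real.Gamma (1 / 2)))
      (1 / 2) := by
  have hG := Real.hasDerivAt_Gamma_one_half.differentiableAt.hasDerivAt
  have hpos : 0 < Real.Gamma (1 / 2) := Real.Gamma_pos_of_pos (by norm_num)
  have e : (1 : ℝ) - 1 / 2 = 1 / 2 := by norm_num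
  have hG' : HasDerivAt (fun x : ℝ => Real.Gamma (1 - x)) (deriv Real.Gamma (1 / 2) * -1)
      (1 / 2) := by
    refine HasDerivAt.comp (1 / 2 : ℝ) (h₂ := Real.Gamma) (h := fun x => 1 - x) ?_ ?_
    · simpa only [e] using hG
    · exact (hasDerivAt_id _).const_sub 1
  have h1 := (hG'.div hG hpos.ne').log (by simp only [Pi.div_apply, e]; positivity)
  have h2 := ((((hasDerivAt_id (1 / 2 : ℝ)).const_mul 2).const_sub 1).mul_const
    (Real.log (2 * Real.pi))).add h1
  refine (h2.const_mul (Real.pi / 2)).congr_deriv ?_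
  simp only [e, Pi.div_apply]
  field_simp
  ring

theorem tendsto_log_Gamma_ratio_div_sin :
    Tendsto (fun x : ℝ => Real.pi / (2 * Real.sin (2 * Real.pi * x)) *
        ((1 - 2 * x) * Real.log (2 * Real.pi) +
          Real.log (Real.Gamma (1 - x) / Real.Gamma x)))
      (𝓝[≠] (1 / 2 : ℝ))
      (𝓝 (Real.log (√(2 * Real.pi)) + deriv Real.Gamma (1 / 2) / (2 * Real.Gamma (1 / 2)))) := by
  have hpos : 0 < Real.Gamma (1 / 2) := Real.Gamma_pos_of_pos (by norm_num)
  have hs : HasDerivAt (fun x : ℝ => Real.sin (2 * Real.pi * x)) (-(2 * Real.pi)) (1 / 2) := by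
    refine ((hasDerivAt_id (1 / 2 : ℝ)).const_mul (2 * Real.pi)).sin.congr_deriv ?_
    simp only [id]
    rw [show 2 * Real.pi * (1 / 2) = Real.pi by ring, Real.cos_pi]
    ring
  have h1 := hasDerivAt_iff_tendsto_slope.1 hasDerivAt_log_Gamma_ratio
  have h2 := hasDerivAt_iff_tendsto_slope.1 hs
  -- Numerator and denominator both vanish at 1/2, so their quotient is a quotient of slopes.
  have h3 := h1.div h2 (by simp [Real.pi_ne_zero])
  have e : -Real.pi * (Real.log (2 * Real.pi) + deriv Real.Gamma (1 / 2) / Real.Gamma (1 / 2)) /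
      -(2 * Real.pi) =
      Real.log (√(2 * Real.pi)) + deriv Real.Gamma (1 / 2) / (2 * Real.Gamma (1 / 2)) := by
    rw [Real.log_sqrt (by positivity)]
    field_simp
  rw [e] at h3
  refine h3.congr' ?_
  filter_upwards [self_mem_nhdsWithin] with x hx
  have hx : x - 1 / 2 ≠ 0 := sub_ne_zero.2 hx
  simp only [Pi.div_apply, slope_def_field]
  rw [show 2 * Real.pi * (1 / 2) = Real.pi by ring, Real.sin_pi, show (1 : ℝ) - 1 / 2 = 1 / 2 by
    norm_num, div_self hpos.ne', Real.log_one, show (1 : ℝ) - 2 * (1 / 2) = 0 by norm_num, zero_mul,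
    add_zero, mul_zero, sub_zero, sub_zero, div_div_div_cancel_right₀ hx]
  ring

theorem tendsto_log_Gamma_ratio_div_sin_integral :
    Tendsto (fun x : ℝ => Real.pi / (2 * Real.sin (2 * Real.pi * x)) *
        ((1 - 2 * x) * Real.log (2 * Real.pi) +
          Real.log (Real.Gamma (1 - x) / Real.Gamma x)))
      (𝓝[≠] (1 / 2 : ℝ))
      (𝓝 (∫ u in (0 : ℝ)..1, Real.log (Real.log (1 / u)) / (u + 1) ^ 2)) := by
  refine (tendsto_integral_log_log_div.mono_left nhdsWithin_le_nhds).congr' ?_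
  filter_upwards [self_mem_nhdsWithin,
    nhdsWithin_le_nhds (Ioo_mem_nhds (show (0 : ℝ) < 1 / 2 by norm_num)
      (show (1 / 2 : ℝ) < 1 by norm_num))] with x hx hx'
  exact integral_log_log_div hx'.1 hx'.2 hx

theorem intervalIntegrable_log_log_div_add_one_sq :
    IntervalIntegrable (fun u : ℝ => Real.log (Real.log (1 / u)) / (u + 1) ^ 2) volume 0 1 := by
  simp only [div_eq_mul_inv _ ((_ + 1 : ℝ) ^ 2)]
  refine intervalIntegrable_log_log.mul_continuousOn ?_
  rw [Set.uIcc_of_le zero_le_one]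
  refine ContinuousOn.inv₀ (by fun_prop) fun u hu => ?_
  have := hu.1
  positivity

theorem log_sqrt_two_pi_add_logDeriv_Gamma_one_half :
    Real.log (√(2 * Real.pi)) + deriv Real.Gamma (1 / 2) / (2 * Real.Gamma (1 / 2)) =
      Real.log (√(Real.pi / 2)) - Real.eulerMascheroniConstant / 2 := by
  rw [Real.hasDerivAt_Gamma_one_half.deriv, Real.Gamma_one_half_eq, Real.log_sqrt (by positivity),
    Real.log_sqrt (by positivity), Real.log_mul two_ne_zero Real.pi_ne_zero,
    Real.log_div Real.pi_ne_zero two_ne_zero]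
  field_simp
  ring

theorem proposition2 :
    (∀ x : ℝ, 0 < x → x < 1 → x ≠ 1 / 2 →
      IntervalIntegrable
        (fun u : ℝ => Real.log (Real.log (1 / u)) / (u ^ 2 - 2 * Real.cos (2 * Real.pi * x) * u + 1))
        volume 0 1 ∧
      ∫ u in (0 : ℝ)..1,
          Real.log (Real.log (1 / u)) / (u ^ 2 - 2 * Real.cos (2 * Real.pi * x) * u + 1) =
        Real.pi / (2 * Real.sin (2 * Real.pi * x)) *
          ((1 - 2 * x) * Real.log (2 * Real.pi) +
            Real.log (Real.Gamma (1 - x) / Real.Gamma x))) ∧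
    Tendsto
      (fun x : ℝ => Real.pi / (2 * Real.sin (2 * Real.pi * x)) *
        ((1 - 2 * x) * Real.log (2 * Real.pi) +
          Real.log (Real.Gamma (1 - x) / Real.Gamma x)))
      (𝓝[≠] (1 / 2 : ℝ))
      (𝓝 (∫ u in (0 : ℝ)..1, Real.log (Real.log (1 / u)) / (u + 1) ^ 2)) ∧
    IntervalIntegrable (fun u : ℝ => Real.log (Real.log (1 / u)) / (u + 1) ^ 2) volume 0 1 ∧
    ∫ u in (0 : ℝ)..1, Real.log (Real.log (1 / u)) / (u + 1) ^ 2 =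
      Real.log (Real.sqrt (2 * Real.pi)) +
        deriv Real.Gamma (1 / 2) / (2 * Real.Gamma (1 / 2)) ∧
    Real.log (Real.sqrt (2 * Real.pi)) +
        deriv Real.Gamma (1 / 2) / (2 * Real.Gamma (1 / 2)) =
      Real.log (Real.sqrt (Real.pi / 2)) - Real.eulerMascheroniConstant / 2 :=
  ⟨fun _ hx0 hx1 hx => ⟨intervalIntegrable_log_log_div hx0 hx1 hx, integral_log_log_div hx0 hx1 hx⟩,
    tendsto_log_Gamma_ratio_div_sin_integral, intervalIntegrable_log_log_div_add_one_sq,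
    tendsto_nhds_unique tendsto_log_Gamma_ratio_div_sin_integral tendsto_log_Gamma_ratio_div_sin,
    log_sqrt_two_pi_add_logDeriv_Gamma_one_half⟩
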